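/- **Setting.** For $0<a\le 1$ let $$f(x,y)=F(xy),\qquad F(s)=F_a(s)=\frac{\bigl(\log(e^{s-1}+1)+\log(e^{1-s}+1)\bigr)^a}{a\,2^{a-2}(\log 2)^{a-1}} ,$$ and let $q(\delta)=F'(1+\delta)/\delta$ for $\delta\ne0$, $q(0)=1$. Let $q^{-1}$ be the inverse of the (strictly decreasing) restriction of $q$ to $[0,\infty)$, and put $$c_1=c_1(a)=-\frac{-3+3a-2\log 2}{24\log 2}>0 .$$ Gradient descent (GD) with learning rate $h$ is $u_{k+1}=u_k-h\nabla f(u_k)$, with $u_k=(x_k,y_k)\in\mathbb R^2$. Write $R=x_0^2+y_0^2$. **Theorem.** There is a universal constant $c>0$ such that for every $0<a\le1$ there is a Lebesgue-null set $\mathcal B_a\subset\mathbb R^2$ with the following property. Let $(x_0,y_0)\in\mathbb R^2\setminus\mathcal B_a$ satisfy $$1<x_0y_0\le q^{-1}\!\left(\frac{q(1)}2\right)+c\,\frac{\log R}{R},\qquad 4c_1^{-4/3}\le R+c\,\frac{\log R}{R},$$ and let the learning rate $h$ satisfy, for some real number $K$ (the constant of an $\mathcal O(R^{-2})$ term, which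 may be arbitrary), $$\frac 2R<\frac{2/q(1)}{R}+\frac{K}{R^2}\le h\le\frac4R .$$ Then GD started at $(x_0,y_0)$ converges to a global minimum of $f$, that is, $(x_k,y_k)\to(x_\infty,y_\infty)$ for some global minimizer $(x_\infty,y_\infty)$ of $f$, and $x_\infty y_\infty=1$. -/

import Mathlib

open Filter Topology MeasureTheory

noncomputable section

namespace GoodRegularity

/-- The parameter plane `ℝ²` with its Euclidean norm and Lebesgue measure; a point `u` has the
coordinates `x = u 0` and `y = u 1`. -/
abbrev Plane : Type := EuclideanSpace ℝ (Fin 2)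

/-- The constant `C_a = 1 / (a 2^(a-2) (log 2)^(a-1))`. -/
def Ca (a : ℝ) : ℝ := 1 / (a * (2 : ℝ) ^ (a - 2) * Real.log 2 ^ (a - 1))

/-- The scalar profile `F(s) = C_a (log (e^(s-1) + 1) + log (e^(1-s) + 1))^a`. -/
def F (a s : ℝ) : ℝ :=
  Ca a * (Real.log (Real.exp (s - 1) + 1) + Real.log (Real.exp (1 - s) + 1)) ^ a

/-- The objective function `f(x, y) = F(xy)`. -/
def f (a : ℝ) (u : Plane) : ℝ := F a (u 0 * u 1)

/-- Gradient descent `u_{k+1} = u_k - h ∇f(u_k)` with constant learning rate `h`. -/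
def gd (a h : ℝ) (u₀ : Plane) : ℕ → Plane
  | 0 => u₀
  | k + 1 => gd a h u₀ k - h • gradient (f a) (gd a h u₀ k)

/-- `q(δ) = F'(δ + 1) / δ`, extended continuously by `q(0) = F''(1) = 1`. -/
def q (a δ : ℝ) : ℝ := if δ = 0 then 1 else deriv (F a) (δ + 1) / δ

/-- `q⁻¹`, the inverse of the restriction of the even function `q` to `[0, ∞)`, where `q` is
strictly decreasing from `1` to `0`. -/
def qInv (a v : ℝ) : ℝ := Function.invFunOn (q a) (Set.Ici 0) v

/-- The constant `c₁ = -(-3 + 3a - 2 log 2) / (24 log 2)`. -/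
def c₁ (a : ℝ) : ℝ := -(-3 + 3 * a - 2 * Real.log 2) / (24 * Real.log 2)

/-- The squared Euclidean norm `x² + y²`. -/
def sqNorm (u : Plane) : ℝ := u 0 ^ 2 + u 1 ^ 2

/-- The relation `g₁ ≲ g₂` for the initial point `u₀ = (x₀, y₀)`, with constant `c`:
`g₁ ≤ g₂ + c log (x₀² + y₀²) / (x₀² + y₀²)`. -/
def ApproxLE (c : ℝ) (u₀ : Plane) (g₁ g₂ : ℝ) : Prop :=
  g₁ ≤ g₂ + c * (Real.log (sqNorm u₀) / sqNorm u₀)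

end GoodRegularity

end

/-! Put s = xy, δ = s − 1 and g = h F'(s). A step multiplies x + y by 1 − g and x − y by 1 + g,
hence x² − y² by 1 − g². Since |F'| ≤ 2 and h ≤ 4/R with R ≥ 22.75, always |g| ≤ 0.352. So x² − y²
converges, and |δ| ≤ 13 persists (`abs_mul_sub_one_le`), a range on which F'(s) = q(δ)δ with q ≥ κ >
0.

If the product of the factors 1 − g² has a positive limit, then g → 0 and so s → 1. Otherwise x² −
y² → 0: the trajectory approaches the diagonal, where |x + y|/2 is contracted towards 1 up to a
vanishing error, so again s → 1. The limits of s and x² − y², with the constant sign of x + y,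
determine those of x and y. The dichotomy covers every trajectory, so the exceptional set can be
empty. -/

namespace GoodRegularity

/-! ### Scalar estimates -/

/-- One gradient descent step keeps the product `s = 1 + δ` in a fixed interval. -/
theorem abs_step_le {δ R h p : ℝ} (hh : 0 < h) (hh' : h ≤ 0.176) (hR : |2 * (1 + δ)| ≤ R)
    (hp : |p| ≤ 2) (hpos : 0 ≤ δ → 0 ≤ p) (hneg : δ ≤ 0 → p ≤ 0) (hhR : h * R ≤ 6.35)
    (hδ : |δ| ≤ 13) : |δ - h * R * p + h ^ 2 * (1 + δ) * p ^ 2| ≤ 13 := by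
  obtain ⟨hR1, hR2⟩ := abs_le.1 hR
  obtain ⟨hp1, hp2⟩ := abs_le.1 hp
  obtain ⟨hd1, hd2⟩ := abs_le.1 hδ
  have hR0 : 0 ≤ R := (abs_nonneg _).trans hR
  have hhR0 : 0 ≤ h * R := by positivity
  have hg : (h * p) ^ 2 ≤ 0.13 := by
    have h1 : |h * p| ≤ 0.352 := by
      rw [abs_mul, abs_of_pos hh]
      nlinarith [abs_nonneg p]
    have := sq_le_sq' (neg_le_of_abs_le h1) (le_of_abs_le h1)
    norm_num at this ⊢
    linarith
  have e : h ^ 2 * (1 + δ) * p ^ 2 = (1 + δ) * (h * p) ^ 2 := by ring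
  have hup : (1 + δ) * (h * p) ^ 2 ≤ R / 2 * (h * p) ^ 2 :=
    mul_le_mul_of_nonneg_right (by linarith) (sq_nonneg _)
  have hlo : -(R / 2) * (h * p) ^ 2 ≤ (1 + δ) * (h * p) ^ 2 :=
    mul_le_mul_of_nonneg_right (by linarith) (sq_nonneg _)
  have e2 : R / 2 * (h * p) ^ 2 = h * R * (h * p ^ 2 / 2) := by ring
  rw [e, abs_le]
  -- For δ ≥ 0 the quadratic term lies in [0, hRp], because 1 + δ ≤ R/2 and hp ≤ 2, so the new δ
  -- lies in [−12.7, δ]. For δ ≤ 0 the same bound keeps it above δ, and 1 + δ ≤ 1 makes it at most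
  -- 12.7 + 0.13.
  rcases le_total 0 δ with h0 | h0
  · have p0 := hpos h0
    have k1 : h * R * p ≤ 12.7 := by nlinarith
    have k2 : h * p ^ 2 / 2 ≤ p := by nlinarith [mul_nonneg hh.le p0]
    have k3 := mul_le_mul_of_nonneg_left k2 hhR0
    have k4 : 0 ≤ (1 + δ) * (h * p) ^ 2 := by positivity
    constructor <;> linarith
  · have p0 := hneg h0
    have k1 : -12.7 ≤ h * R * p := by nlinarith
    have k2 : h * p ^ 2 / 2 ≤ -p := by nlinarith [mul_nonneg hh.le (neg_nonneg.2 p0)]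
    have k3 := mul_le_mul_of_nonneg_left k2 hhR0
    have k4 : (1 + δ) * (h * p) ^ 2 ≤ 1 * (h * p) ^ 2 :=
      mul_le_mul_of_nonneg_right (by linarith) (sq_nonneg _)
    constructor <;> linarith

/-- A perturbed contraction `e' = m e + ε` with `ε → 0` tends to zero. -/
theorem tendsto_zero_of_perturbed_contraction {e ε : ℕ → ℝ} {ρ : ℝ} (hρ0 : 0 ≤ ρ) (hρ : ρ < 1)
    (he : ∀ᶠ k in atTop, |e (k + 1)| ≤ ρ * |e k| + ε k) (hb : ∃ M, ∀ k, |e k| ≤ M)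
    (hε : Tendsto ε atTop (𝓝 0)) : Tendsto e atTop (𝓝 0) := by
  obtain ⟨M, hM⟩ := hb
  have hbdd : IsBoundedUnder (· ≤ ·) atTop fun k => |e k| :=
    isBoundedUnder_of ⟨M, hM⟩
  have hcob : IsCoboundedUnder (· ≤ ·) atTop fun k => |e k| :=
    IsCoboundedUnder.of_frequently_ge (a := 0) (Frequently.of_forall fun k => abs_nonneg _)
  set S := limsup (fun k => |e k|) atTop with hS
  have hS0 : 0 ≤ S := le_limsup_of_frequently_le (Frequently.of_forall fun k => abs_nonneg _) hbdd
  have key : ∀ η > 0, S ≤ ρ * (S + η) + η := by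
    intro η hη
    have h1 : ∀ᶠ k in atTop, |e k| < S + η :=
      eventually_lt_of_limsup_lt (by linarith) hbdd
    have h2 : ∀ᶠ k in atTop, ε k < η := hε.eventually_lt_const hη
    have h3 : ∀ᶠ k in atTop, |e (k + 1)| ≤ ρ * (S + η) + η := by
      filter_upwards [he, h1, h2] with k a b c
      have := mul_le_mul_of_nonneg_left b.le hρ0
      linarith
    have h4 : ∀ᶠ k in atTop, |e k| ≤ ρ * (S + η) + η := by
      obtain ⟨N, hN⟩ := eventually_atTop.1 h3
      refine eventually_atTop.2 ⟨N + 1, fun k hk => ?_⟩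
      have := hN (k - 1) (by omega)
      rwa [Nat.sub_add_cancel (by omega)] at this
    exact limsup_le_of_le hcob h4
  have hS' : S ≤ 0 := by
    by_contra hc
    push Not at hc
    -- With this η, `key` gives S ≤ ρS + (1 + ρ)η < ρS + (1 − ρ)S/2, absurd for S > 0.
    have := key ((1 - ρ) * S / 4) (by nlinarith [mul_pos (sub_pos.2 hρ) hc])
    nlinarith [mul_pos (sub_pos.2 hρ) hc]
  rw [tendsto_zero_iff_abs_tendsto_zero]
  refine tendsto_order.2 ⟨fun b hb => Eventually.of_forall fun k => hb.trans_le (abs_nonneg _),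
    fun b hb => eventually_lt_of_limsup_lt (lt_of_le_of_lt hS' hb) hbdd⟩

/-- The contraction factor of gradient descent on the diagonal, `w` being half of `x + y`. -/
theorem abs_one_sub_le {h w r q δ κ : ℝ} (hh : 0 < h) (hh' : h ≤ 0.176) (hw : 0.6 ≤ w)
    (hκ : 0 ≤ κ) (hκq : κ ≤ q) (hq1 : q ≤ 1) (hqδ : q * δ ≤ 2) (hr : r ≤ 1)
    (hδ : δ = w ^ 2 - 1 - r) :
    |1 - h * w * (w + 1) * q| ≤ max (1 - h * 0.96 * κ) 0.6 := by
  have hq0 : 0 ≤ q := hκ.trans hκq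
  have hlow : h * 0.96 * κ ≤ h * w * (w + 1) * q := by
    have : (0.96 : ℝ) ≤ w * (w + 1) := by nlinarith
    have h2 : 0.96 * κ ≤ w * (w + 1) * q := mul_le_mul this hκq hκ (by nlinarith)
    nlinarith [mul_le_mul_of_nonneg_left h2 hh.le]
  -- For small w use q ≤ 1; for w ≥ 2.5, w(w + 1) is comparable to δ and qδ ≤ 2 takes over.
  have hA : w * (w + 1) * q ≤ 8.75 := by
    rcases le_total w 2.5 with h1 | h1
    · have : w * (w + 1) ≤ 8.75 := by nlinarith
      nlinarith
    · have h3 : w * (w + 1) ≤ 2.1 * δ := by nlinarith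
      nlinarith
  have hup : h * w * (w + 1) * q ≤ 1.6 := by
    have h0 : 0 ≤ w * (w + 1) * q := by positivity
    have : h * (w * (w + 1) * q) ≤ 0.176 * 8.75 := mul_le_mul hh' hA h0 (by norm_num)
    nlinarith
  rw [abs_le]
  have l1 := le_max_left (1 - h * 0.96 * κ) 0.6
  have l2 := le_max_right (1 - h * 0.96 * κ) 0.6
  constructor <;> linarith

end GoodRegularity

/-! ### Dynamics of a trajectory -/

namespace GoodRegularity

theorem sq_add_sq_eq_sqrt (x y : ℝ) :
    x ^ 2 + y ^ 2 = √((x ^ 2 - y ^ 2) ^ 2 + 4 * (x * y) ^ 2) := by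
  rw [show (x ^ 2 - y ^ 2) ^ 2 + 4 * (x * y) ^ 2 = (x ^ 2 + y ^ 2) ^ 2 by ring,
    Real.sqrt_sq (by positivity)]

/-- Coordinatewise description of a gradient descent trajectory of `(x, y) ↦ F(xy)`, where
`F'(1 + δ) = Q(δ) δ`, with the bounds that force convergence. -/
structure Trajectory (X Y : ℕ → ℝ) (Q : ℝ → ℝ) (h κ : ℝ) : Prop where
  h_pos : 0 < h
  h_le : h ≤ 0.176
  h_norm : h * (X 0 ^ 2 + Y 0 ^ 2) ≤ 4
  κ_pos : 0 < κ
  Q_nonneg : ∀ δ, 0 ≤ Q δ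
  Q_le_one : ∀ δ, Q δ ≤ 1
  Q_mul_le : ∀ δ, |Q δ * δ| ≤ 2
  κ_le : ∀ δ, |δ| ≤ 13 → κ ≤ Q δ
  one_le : 1 ≤ X 0 * Y 0
  le_fourteen : X 0 * Y 0 ≤ 14
  X_succ : ∀ k, X (k + 1) = X k - h * (Q (X k * Y k - 1) * (X k * Y k - 1) * Y k)
  Y_succ : ∀ k, Y (k + 1) = Y k - h * (Q (X k * Y k - 1) * (X k * Y k - 1) * X k)

/-- The relative step size `h F'(xy)` of a trajectory. -/
def relStep (X Y : ℕ → ℝ) (Q : ℝ → ℝ) (h : ℝ) (k : ℕ) : ℝ :=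
  h * (Q (X k * Y k - 1) * (X k * Y k - 1))

namespace Trajectory

variable {X Y : ℕ → ℝ} {Q : ℝ → ℝ} {h κ : ℝ} (T : Trajectory X Y Q h κ)

include T

theorem abs_relStep_le (k : ℕ) : |relStep X Y Q h k| ≤ 0.352 := by
  have := T.Q_mul_le (X k * Y k - 1)
  have h1 := T.h_pos
  have h2 := T.h_le
  rw [relStep, abs_mul, abs_of_pos h1]
  nlinarith [abs_nonneg (Q (X k * Y k - 1) * (X k * Y k - 1))]

theorem relStep_sq_le (k : ℕ) : relStep X Y Q h k ^ 2 ≤ 0.13 := by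
  have h1 := T.abs_relStep_le k
  have := sq_le_sq' (neg_le_of_abs_le h1) (le_of_abs_le h1)
  norm_num at this ⊢
  linarith

theorem add_succ (k : ℕ) :
    X (k + 1) + Y (k + 1) = (X k + Y k) * (1 - relStep X Y Q h k) := by
  rw [T.X_succ, T.Y_succ, relStep]; ring

theorem sub_succ (k : ℕ) :
    X (k + 1) - Y (k + 1) = (X k - Y k) * (1 + relStep X Y Q h k) := by
  rw [T.X_succ, T.Y_succ, relStep]; ring

theorem sq_sub_sq_eq (k : ℕ) :
    X k ^ 2 - Y k ^ 2 =
      (X 0 ^ 2 - Y 0 ^ 2) * ∏ i ∈ Finset.range k, (1 - relStep X Y Q h i ^ 2) := by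
  induction k with
  | zero => simp
  | succ k ih =>
    rw [Finset.prod_range_succ, ← mul_assoc, ← ih]
    have h1 := T.add_succ k
    have h2 := T.sub_succ k
    calc X (k + 1) ^ 2 - Y (k + 1) ^ 2
        = (X (k + 1) + Y (k + 1)) * (X (k + 1) - Y (k + 1)) := by ring
      _ = _ := by rw [h1, h2]; ring

theorem prod_mem (k : ℕ) :
    0 < ∏ i ∈ Finset.range k, (1 - relStep X Y Q h i ^ 2) ∧
      ∏ i ∈ Finset.range k, (1 - relStep X Y Q h i ^ 2) ≤ 1 := by
  constructor
  · exact Finset.prod_pos fun i _ => by linarith [T.relStep_sq_le i]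
  · exact Finset.prod_le_one (fun i _ => by linarith [T.relStep_sq_le i])
      fun i _ => by linarith [sq_nonneg (relStep X Y Q h i)]

theorem abs_sq_sub_sq_le (k : ℕ) : |X k ^ 2 - Y k ^ 2| ≤ |X 0 ^ 2 - Y 0 ^ 2| := by
  rw [T.sq_sub_sq_eq k, abs_mul, abs_of_pos (T.prod_mem k).1]
  exact mul_le_of_le_one_right (abs_nonneg _) (T.prod_mem k).2

theorem abs_mul_sub_one_le (k : ℕ) : |X k * Y k - 1| ≤ 13 := by
  induction k with
  | zero =>
    have := T.one_le
    have := T.le_fourteen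
    rw [abs_le]; constructor <;> linarith
  | succ k ih =>
    have hh := T.h_pos
    -- Use (x² + y²)² = (x² − y²)² + 4s² with |s| ≤ 14 and 4 · 14² = 784; then 16 + 784 · 0.176² <
    -- 6.35².
    have hhR : h * (X k ^ 2 + Y k ^ 2) ≤ 6.35 := by
      have h1 := sq_le_sq.2 (T.abs_sq_sub_sq_le k)
      obtain ⟨b1, b2⟩ := abs_le.1 ih
      have h3 : (X k ^ 2 + Y k ^ 2) ^ 2 ≤ (X 0 ^ 2 + Y 0 ^ 2) ^ 2 + 784 := by
        nlinarith [sq_nonneg (X 0 * Y 0)]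
      have h4 : (h * (X 0 ^ 2 + Y 0 ^ 2)) ^ 2 ≤ 4 ^ 2 :=
        pow_le_pow_left₀ (by positivity) T.h_norm 2
      have h5 : h ^ 2 ≤ 0.176 ^ 2 := pow_le_pow_left₀ hh.le T.h_le 2
      refine (sq_le_sq₀ (by positivity) (by norm_num)).1 ?_
      have h6 := mul_le_mul_of_nonneg_left h3 (sq_nonneg h)
      norm_num at h4 h5 ⊢
      nlinarith
    have hR : |2 * (1 + (X k * Y k - 1))| ≤ X k ^ 2 + Y k ^ 2 := by
      rw [abs_le]
      constructor <;> nlinarith [sq_nonneg (X k + Y k), sq_nonneg (X k - Y k)]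
    have hq := T.Q_nonneg (X k * Y k - 1)
    have := abs_step_le hh T.h_le hR (T.Q_mul_le _) (fun h0 => mul_nonneg hq h0)
      (fun h0 => mul_nonpos_of_nonneg_of_nonpos hq h0) hhR ih
    convert this using 2
    rw [T.X_succ, T.Y_succ]; ring

/-- Below s = 1 the factor 1 − g is at least 1; above it (x + y)² ≥ 4s ≥ 4, which one step shrinks
at most to 4 · 0.41. This keeps the trajectory away from the saddle at the origin. -/
theorem add_sq_ge (k : ℕ) : 1.44 ≤ (X k + Y k) ^ 2 := by
  induction k with
  | zero => nlinarith [T.one_le, sq_nonneg (X 0 - Y 0)]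
  | succ k ih =>
    rw [T.add_succ, mul_pow]
    have hg := T.abs_relStep_le k
    obtain ⟨g1, g2⟩ := abs_le.1 hg
    have hq := T.Q_nonneg (X k * Y k - 1)
    rcases le_total (X k * Y k) 1 with h1 | h1
    · have : relStep X Y Q h k ≤ 0 :=
        mul_nonpos_of_nonneg_of_nonpos T.h_pos.le
          (mul_nonpos_of_nonneg_of_nonpos hq (by linarith))
      have : 1 ≤ (1 - relStep X Y Q h k) ^ 2 := by nlinarith
      nlinarith
    · have h2 : 4 ≤ (X k + Y k) ^ 2 := by nlinarith [sq_nonneg (X k - Y k)]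
      have h3 : 0.41 ≤ (1 - relStep X Y Q h k) ^ 2 := by
        norm_num at g2 ⊢
        nlinarith
      nlinarith

theorem abs_add_succ (k : ℕ) :
    |X (k + 1) + Y (k + 1)| = |X k + Y k| * (1 - relStep X Y Q h k) := by
  have := le_of_abs_le (T.abs_relStep_le k)
  rw [T.add_succ, abs_mul, abs_of_pos (a := 1 - _)]
  norm_num at this ⊢
  linarith

/-- The factor 1 − g is positive, so x + y never changes sign. -/
theorem exists_sign : ∃ σ : ℝ, ∀ k, X k + Y k = σ * |X k + Y k| := by
  refine ⟨SignType.sign (X 0 + Y 0), fun k => ?_⟩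
  induction k with
  | zero => rw [sign_mul_abs]
  | succ k ih => rw [T.abs_add_succ, ← mul_assoc, ← ih, T.add_succ]

/-- If `xy → 1` and `x² - y²` converges then the trajectory converges. -/
theorem tendsto_of_tendsto_mul {d : ℝ}
    (hs : Tendsto (fun k => X k * Y k) atTop (𝓝 1))
    (hD : Tendsto (fun k => X k ^ 2 - Y k ^ 2) atTop (𝓝 d)) :
    ∃ x y, Tendsto X atTop (𝓝 x) ∧ Tendsto Y atTop (𝓝 y) ∧ x * y = 1 := by
  obtain ⟨σ, hσ⟩ := T.exists_sign
  have hR : Tendsto (fun k => X k ^ 2 + Y k ^ 2) atTop (𝓝 (√(d ^ 2 + 4 * 1 ^ 2))) := by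
    have := ((hD.pow 2).add ((hs.pow 2).const_mul 4)).sqrt
    exact this.congr fun k => (sq_add_sq_eq_sqrt (X k) (Y k)).symm
  obtain ⟨U, hU⟩ : ∃ U, Tendsto (fun k => X k + Y k) atTop (𝓝 U) := by
    refine ⟨_, (((hR.add (hs.const_mul 2)).sqrt).const_mul σ).congr fun k => ?_⟩
    rw [hσ k, ← Real.sqrt_sq_eq_abs]
    congr 2; ring
  have hU0 : U ≠ 0 := by
    have := ge_of_tendsto' (hU.pow 2) T.add_sq_ge
    intro h0
    norm_num [h0] at this
  have hV : Tendsto (fun k => X k - Y k) atTop (𝓝 (d / U)) := by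
    refine (hD.div hU hU0).congr fun k => ?_
    have : X k + Y k ≠ 0 := by
      intro h0
      have := T.add_sq_ge k
      norm_num [h0] at this
    rw [Pi.div_apply, div_eq_iff this]; ring
  have hX : Tendsto X atTop (𝓝 ((U + d / U) / 2)) :=
    ((hU.add hV).div_const 2).congr fun k => by ring
  have hY : Tendsto Y atTop (𝓝 ((U - d / U) / 2)) :=
    ((hU.sub hV).div_const 2).congr fun k => by ring
  exact ⟨_, _, hX, hY, tendsto_nhds_unique (hX.mul hY) hs⟩

/-- If the relative steps tend to zero then `xy → 1`. -/
theorem tendsto_mul_of_tendsto_relStep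
    (hg : Tendsto (fun k => relStep X Y Q h k ^ 2) atTop (𝓝 0)) :
    Tendsto (fun k => X k * Y k) atTop (𝓝 1) := by
  have hc : 0 < h * κ := mul_pos T.h_pos T.κ_pos
  have h2 : Tendsto (fun k => (X k * Y k - 1) ^ 2) atTop (𝓝 0) := by
    refine squeeze_zero (fun k => sq_nonneg _) (fun k => ?_)
      (by simpa using hg.const_mul (((h * κ) ^ 2)⁻¹))
    rw [← div_eq_inv_mul, le_div_iff₀ (by positivity), relStep]
    have hκ := T.κ_le _ (T.abs_mul_sub_one_le k)
    have h3 : (h * κ) ^ 2 ≤ (h * Q (X k * Y k - 1)) ^ 2 :=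
      pow_le_pow_left₀ hc.le (mul_le_mul_of_nonneg_left hκ T.h_pos.le) 2
    nlinarith [mul_le_mul_of_nonneg_left h3 (sq_nonneg (X k * Y k - 1))]
  have h3 : Tendsto (fun k => X k * Y k - 1) atTop (𝓝 0) := by
    rw [tendsto_zero_iff_abs_tendsto_zero]
    have := h2.sqrt
    simpa [Real.sqrt_sq_eq_abs, Function.comp_def] using this
  simpa using h3.add_const 1

/-- If `x² - y² → 0` then `xy → 1`. -/
theorem tendsto_mul_of_tendsto_zero
    (hD : Tendsto (fun k => X k ^ 2 - Y k ^ 2) atTop (𝓝 0)) :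
    Tendsto (fun k => X k * Y k) atTop (𝓝 1) := by
  set r : ℕ → ℝ := fun k => (X k - Y k) ^ 2 / 4 with hr
  set w : ℕ → ℝ := fun k => |X k + Y k| / 2 with hw
  have hw2 : ∀ k, w k ^ 2 = X k * Y k + r k := fun k => by
    simp only [hw, hr, div_pow, sq_abs]; ring
  have hw0 : ∀ k, 0.6 ≤ w k := fun k => by
    have := T.add_sq_ge k
    have h1 : (1.2 : ℝ) ≤ |X k + Y k| := by
      refine (sq_le_sq₀ (by norm_num) (abs_nonneg _)).1 ?_
      rw [sq_abs]; norm_num at this ⊢; linarith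
    simp only [hw]; linarith
  have hr0 : Tendsto r atTop (𝓝 0) := by
    refine squeeze_zero (fun k => by positivity) (fun k => ?_) (by simpa using hD.pow 2)
    have := T.add_sq_ge k
    have e : (X k ^ 2 - Y k ^ 2) ^ 2 = (X k + Y k) ^ 2 * (X k - Y k) ^ 2 := by ring
    simp only [hr]
    rw [e]
    nlinarith [sq_nonneg (X k - Y k)]
  have hrle : ∀ k, 0 ≤ r k := fun k => by positivity
  obtain ⟨B, hB⟩ := hr0.bddAbove_range
  have hB' : ∀ k, r k ≤ B := fun k => hB ⟨k, rfl⟩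
  have hwb : ∀ k, w k ≤ 15 + B := fun k => by
    have h1 := hw2 k
    have h2 := (abs_le.1 (T.abs_mul_sub_one_le k)).2
    nlinarith [hB' k, hw0 k]
  have hB0 : 0 ≤ B := (hrle 0).trans (hB' 0)
  -- Substitute δ = (w − 1)(w + 1) − r in w' = w(1 − hQδ).
  have hrec : ∀ k, w (k + 1) - 1 =
      (1 - h * w k * (w k + 1) * Q (X k * Y k - 1)) * (w k - 1)
        + h * w k * Q (X k * Y k - 1) * r k := fun k => by
    have h1 : w (k + 1) = w k * (1 - relStep X Y Q h k) := by
      simp only [hw]; rw [T.abs_add_succ]; ring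
    rw [h1, relStep]
    linear_combination (-(h * w k * Q (X k * Y k - 1))) * (hw2 k) * (-1)
  have he : Tendsto (fun k => w k - 1) atTop (𝓝 0) := by
    refine tendsto_zero_of_perturbed_contraction (ρ := max (1 - h * 0.96 * κ) 0.6)
      (ε := fun k => (15 + B) * r k) (le_trans (by norm_num) (le_max_right _ _))
      (max_lt ?_ (by norm_num)) ?_ ⟨15 + B, fun k => ?_⟩ (by simpa using hr0.const_mul (15 + B))
    · have := mul_pos T.h_pos T.κ_pos
      norm_num; nlinarith
    · filter_upwards [hr0.eventually_le_const one_pos] with k hk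
      have hq1 := T.Q_le_one (X k * Y k - 1)
      have hq0 := T.Q_nonneg (X k * Y k - 1)
      have h1 := abs_one_sub_le T.h_pos T.h_le (hw0 k) T.κ_pos.le
        (T.κ_le _ (T.abs_mul_sub_one_le k)) hq1 (le_of_abs_le (T.Q_mul_le _)) hk
        (by rw [hw2]; ring)
      rw [hrec]
      refine (abs_add_le _ _).trans (add_le_add ?_ ?_)
      · rw [abs_mul]
        exact mul_le_mul_of_nonneg_right h1 (abs_nonneg _)
      · have hwk : 0 ≤ w k := le_trans (by norm_num) (hw0 k)
        have hh := T.h_pos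
        rw [abs_of_nonneg (by have := hrle k; positivity)]
        refine mul_le_mul_of_nonneg_right ?_ (hrle k)
        have h2 : h * w k ≤ 1 * (15 + B) :=
          mul_le_mul (T.h_le.trans (by norm_num)) (hwb k) hwk zero_le_one
        have h3 : h * w k * Q (X k * Y k - 1) ≤ h * w k * 1 :=
          mul_le_mul_of_nonneg_left hq1 (by positivity)
        linarith
    · have := hw0 k
      have := hwb k
      rw [abs_le]; constructor <;> linarith
  have hw1 : Tendsto w atTop (𝓝 1) := by simpa using he.add_const 1
  have := (hw1.pow 2).sub hr0
  simpa using this.congr fun k => show w k ^ 2 - r k = X k * Y k by rw [hw2]; ring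

theorem exists_tendsto :
    ∃ x y, Tendsto X atTop (𝓝 x) ∧ Tendsto Y atTop (𝓝 y) ∧ x * y = 1 := by
  set P : ℕ → ℝ := fun k => ∏ i ∈ Finset.range k, (1 - relStep X Y Q h i ^ 2) with hP
  have hanti : Antitone P := antitone_nat_of_succ_le fun k => by
    simp only [hP]
    rw [Finset.prod_range_succ]
    exact mul_le_of_le_one_right (T.prod_mem k).1.le
      (by linarith [sq_nonneg (relStep X Y Q h k)])
  obtain ⟨p, hp⟩ : ∃ p, Tendsto P atTop (𝓝 p) :=
    ⟨_, tendsto_atTop_ciInf hanti ⟨0, by rintro _ ⟨k, rfl⟩; exact (T.prod_mem k).1.le⟩⟩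
  have hD : Tendsto (fun k => X k ^ 2 - Y k ^ 2) atTop (𝓝 ((X 0 ^ 2 - Y 0 ^ 2) * p)) :=
    (hp.const_mul _).congr fun k => (T.sq_sub_sq_eq k).symm
  refine T.tendsto_of_tendsto_mul ?_ hD
  by_cases h0 : p = 0
  · rw [h0, mul_zero] at hD
    exact T.tendsto_mul_of_tendsto_zero hD
  · refine T.tendsto_mul_of_tendsto_relStep ?_
    -- Ratios of consecutive partial products tend to 1 when their limit is nonzero.
    have h1 := ((hp.comp (tendsto_add_atTop_nat 1)).div hp h0).const_sub 1
    rw [div_self h0, sub_self] at h1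
    refine h1.congr fun k => ?_
    have := (T.prod_mem k).1.ne'
    simp only [hP, Function.comp_apply, Pi.div_apply]
    rw [Finset.prod_range_succ, mul_div_cancel_left₀ _ this]; ring

end Trajectory

end GoodRegularity

/-! ### The profile F and the function q -/

namespace GoodRegularity

/-- The function `L(t) = log (e^t + 1) + log (e^(-t) + 1)`, of which `F` is a power. -/
noncomputable def logSum (t : ℝ) : ℝ := Real.log (Real.exp t + 1) + Real.log (Real.exp (-t) + 1)

theorem two_log_two_le_logSum (t : ℝ) : 2 * Real.log 2 ≤ logSum t := by
  have h1 : (0 : ℝ) < Real.exp t + 1 := by positivity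
  have h2 : (0 : ℝ) < Real.exp (-t) + 1 := by positivity
  rw [logSum, ← Real.log_mul h1.ne' h2.ne']
  have : 2 * Real.log 2 = Real.log (2 ^ 2) := by rw [Real.log_pow]; norm_num
  rw [this]
  refine Real.log_le_log (by norm_num) ?_
  have e : Real.exp t * Real.exp (-t) = 1 := by rw [← Real.exp_add]; simp
  nlinarith [sq_nonneg (Real.exp t - 1), sq_nonneg (Real.exp (-t) - 1),
    sq_nonneg (Real.exp t + Real.exp (-t) - 2), Real.exp_pos t, Real.exp_pos (-t),
    sq_nonneg (Real.exp t - Real.exp (-t))]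

theorem logSum_pos (t : ℝ) : 0 < logSum t :=
  lt_of_lt_of_le (by have := Real.log_pos one_lt_two; positivity) (two_log_two_le_logSum t)

theorem hasDerivAt_logSum (t : ℝ) :
    HasDerivAt logSum ((Real.exp t - 1) / (Real.exp t + 1)) t := by
  have h1 : (0 : ℝ) < Real.exp t + 1 := by positivity
  have h2 : (0 : ℝ) < Real.exp (-t) + 1 := by positivity
  have d1 := ((Real.hasDerivAt_exp t).add_const 1).log h1.ne'
  have d2 := ((hasDerivAt_neg t).exp.add_const 1).log h2.ne'
  refine (d1.add d2).congr_deriv ?_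
  have e : Real.exp (-t) = (Real.exp t)⁻¹ := Real.exp_neg t
  rw [e]
  have := (Real.exp_pos t).ne'
  field_simp
  ring

theorem F_eq (a s : ℝ) : F a s = Ca a * logSum (s - 1) ^ a := by
  rw [F, logSum, neg_sub]

/-- The weight `(L(t) / (2 log 2))^(a - 1)` in the derivative of `F`. -/
noncomputable def weight (a t : ℝ) : ℝ := (logSum t / (2 * Real.log 2)) ^ (a - 1)

theorem Ca_pos {a : ℝ} (ha : 0 < a) : 0 < Ca a := by
  have := Real.log_pos one_lt_two
  rw [Ca]; positivity

theorem hasDerivAt_F {a : ℝ} (ha : 0 < a) (t : ℝ) :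
    HasDerivAt (F a) (2 * weight a t * ((Real.exp t - 1) / (Real.exp t + 1))) (1 + t) := by
  have hl := Real.log_pos one_lt_two
  have e : F a = fun s => Ca a * logSum (s - 1) ^ a := funext (F_eq a)
  have h0 : HasDerivAt (fun s => logSum (s - 1)) ((Real.exp t - 1) / (Real.exp t + 1)) (1 + t) := by
    have h1 : HasDerivAt logSum ((Real.exp t - 1) / (Real.exp t + 1)) (1 + t - 1) := by
      rw [add_sub_cancel_left]; exact hasDerivAt_logSum t
    exact (h1.comp (1 + t) ((hasDerivAt_id (1 + t)).sub_const 1)).congr_deriv (mul_one _)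
  have h1 := (h0.rpow_const (p := a) (Or.inl (logSum_pos _).ne')).const_mul (Ca a)
  rw [e]
  refine h1.congr_deriv ?_
  rw [add_sub_cancel_left, weight, Real.div_rpow (logSum_pos t).le (by positivity),
    Real.mul_rpow (by norm_num) hl.le, Ca]
  have e1 : (2 : ℝ) ^ (a - 1) = 2 ^ (a - 2) * 2 := by
    rw [← Real.rpow_add_one (by norm_num)]; congr 1; ring
  rw [e1]
  have p1 : (0 : ℝ) < 2 ^ (a - 2) := by positivity
  have p2 : 0 < Real.log 2 ^ (a - 1) := by positivity
  field_simp

theorem weight_pos (a t : ℝ) : 0 < weight a t := by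
  have := Real.log_pos one_lt_two
  have := logSum_pos t
  rw [weight]; positivity

theorem one_le_ratio (t : ℝ) : 1 ≤ logSum t / (2 * Real.log 2) := by
  have := Real.log_pos one_lt_two
  rw [one_le_div (by positivity)]
  exact two_log_two_le_logSum t

theorem weight_le_one {a : ℝ} (ha : a ≤ 1) (t : ℝ) : weight a t ≤ 1 :=
  Real.rpow_le_one_of_one_le_of_nonpos (one_le_ratio t) (by linarith)

/-- The exponent satisfies a − 1 ≥ −1 and the base is at least 1, which makes the bound independent
of a. -/
theorem inv_le_weight {a : ℝ} (ha : 0 < a) {t m : ℝ}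
    (hm : logSum t / (2 * Real.log 2) ≤ m) : m⁻¹ ≤ weight a t := by
  have h1 := one_le_ratio t
  have h2 : m⁻¹ ≤ (logSum t / (2 * Real.log 2))⁻¹ := inv_anti₀ (by linarith) hm
  refine h2.trans ?_
  rw [← Real.rpow_neg_one, weight]
  exact Real.rpow_le_rpow_of_exponent_le h1 (by linarith)

theorem exp_ratio_neg (t : ℝ) : (Real.exp (-t) - 1) / (Real.exp (-t) + 1) =
    -((Real.exp t - 1) / (Real.exp t + 1)) := by
  rw [Real.exp_neg]
  have := Real.exp_pos t
  field_simp
  ring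

theorem logSum_neg (t : ℝ) : logSum (-t) = logSum t := by
  rw [logSum, logSum, neg_neg, add_comm]

/-- Equivalent to (t − 2)eᵗ + t ≥ −2, its value at 0; the derivative (t − 1)eᵗ + 1 is nonnegative
because e⁻ᵗ ≥ 1 − t. -/
theorem exp_ratio_le {t : ℝ} (ht : 0 ≤ t) : (Real.exp t - 1) / (Real.exp t + 1) ≤ t / 2 := by
  have hd : ∀ x : ℝ, HasDerivAt (fun x => (x - 2) * Real.exp x + x)
      (1 * Real.exp x + (x - 2) * Real.exp x + 1) x := fun x =>
    (((hasDerivAt_id x).sub_const 2).mul (Real.hasDerivAt_exp x)).add (hasDerivAt_id x)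
  have hm : Monotone fun x => (x - 2) * Real.exp x + x := by
    refine monotone_of_deriv_nonneg (fun x => (hd x).differentiableAt) fun x => ?_
    rw [(hd x).deriv]
    have h1 := Real.add_one_le_exp (-x)
    have h2 : Real.exp (-x) * Real.exp x = 1 := by rw [← Real.exp_add]; simp
    nlinarith [Real.exp_pos x]
  have := hm ht
  simp at this
  rw [div_le_div_iff₀ (by positivity) (by norm_num)]
  nlinarith

theorem q_zero (a : ℝ) : q a 0 = 1 := by simp [q]

theorem q_of_ne {a δ : ℝ} (ha : 0 < a) (hδ : δ ≠ 0) :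
    q a δ = 2 * weight a δ * ((Real.exp δ - 1) / (Real.exp δ + 1)) / δ := by
  rw [q, if_neg hδ, add_comm, (hasDerivAt_F ha δ).deriv]

theorem q_neg {a : ℝ} (ha : 0 < a) (δ : ℝ) : q a (-δ) = q a δ := by
  rcases eq_or_ne δ 0 with rfl | h
  · simp
  · rw [q_of_ne ha h, q_of_ne ha (neg_ne_zero.2 h), exp_ratio_neg, weight, weight, logSum_neg]
    field_simp

theorem q_abs {a : ℝ} (ha : 0 < a) (δ : ℝ) : q a |δ| = q a δ := by
  rcases abs_choice δ with h | h <;> rw [h]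
  exact q_neg ha δ

theorem deriv_F_eq {a : ℝ} (ha : 0 < a) (δ : ℝ) : deriv (F a) (1 + δ) = q a δ * δ := by
  rcases eq_or_ne δ 0 with rfl | h
  · rw [(hasDerivAt_F ha 0).deriv]; simp
  · rw [q, if_neg h, div_mul_cancel₀ _ h, add_comm]

theorem exp_ratio_nonneg {t : ℝ} (ht : 0 ≤ t) : 0 ≤ (Real.exp t - 1) / (Real.exp t + 1) :=
  div_nonneg (by linarith [Real.one_le_exp ht]) (by positivity)

theorem exp_ratio_le_one (t : ℝ) : (Real.exp t - 1) / (Real.exp t + 1) ≤ 1 := by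
  rw [div_le_one (by positivity)]; linarith

theorem q_nonneg {a : ℝ} (ha : 0 < a) (δ : ℝ) : 0 ≤ q a δ := by
  rw [← q_abs ha]
  rcases (abs_nonneg δ).eq_or_lt with h | h
  · rw [← h, q_zero]; norm_num
  · rw [q_of_ne ha h.ne']
    have := exp_ratio_nonneg h.le
    have := weight_pos a |δ|
    positivity

theorem q_le_one {a : ℝ} (ha : 0 < a) (ha1 : a ≤ 1) (δ : ℝ) : q a δ ≤ 1 := by
  rw [← q_abs ha]
  rcases (abs_nonneg δ).eq_or_lt with h | h
  · rw [← h, q_zero]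
  · rw [q_of_ne ha h.ne', div_le_one h]
    have h1 := exp_ratio_le h.le
    have h2 := mul_le_mul (weight_le_one ha1 |δ|) h1 (exp_ratio_nonneg h.le) zero_le_one
    linarith

theorem abs_q_mul_le {a : ℝ} (ha : 0 < a) (ha1 : a ≤ 1) (δ : ℝ) : |q a δ * δ| ≤ 2 := by
  rw [abs_mul, abs_of_nonneg (q_nonneg ha δ), ← q_abs ha]
  rcases (abs_nonneg δ).eq_or_lt with h | h
  · rw [← h]; norm_num
  · rw [q_of_ne ha h.ne', div_mul_cancel₀ _ h.ne']
    have h2 := mul_le_mul (weight_le_one ha1 |δ|) (exp_ratio_le_one |δ|)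
      (exp_ratio_nonneg h.le) zero_le_one
    linarith

theorem continuous_logSum : Continuous logSum :=
  continuous_iff_continuousAt.2 fun t => (hasDerivAt_logSum t).continuousAt

theorem exists_pos_le_q {a : ℝ} (ha : 0 < a) (M : ℝ) :
    ∃ κ > 0, ∀ δ, |δ| ≤ M → κ ≤ q a δ := by
  obtain ⟨m, hm⟩ := (isCompact_Icc (a := (0 : ℝ)) (b := M)).bddAbove_image
    (f := fun t => logSum t / (2 * Real.log 2))
    ((continuous_logSum.div_const _).continuousOn)
  set m' := max m 1 with hm'
  have hm1 : 0 < m' := lt_of_lt_of_le one_pos (le_max_right _ _)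
  refine ⟨min 1 (2 * m'⁻¹ * (1 / (Real.exp M + 1))), by positivity, fun δ hδ => ?_⟩
  rw [← q_abs ha]
  rcases (abs_nonneg δ).eq_or_lt with h | h
  · rw [← h, q_zero]; exact min_le_left _ _
  · refine (min_le_right _ _).trans ?_
    rw [q_of_ne ha h.ne', mul_div_assoc]
    have h1 : m'⁻¹ ≤ weight a |δ| :=
      inv_le_weight ha ((hm ⟨|δ|, ⟨h.le, hδ⟩, rfl⟩).trans (le_max_left _ _))
    have h2 : 1 / (Real.exp M + 1) ≤ (Real.exp |δ| - 1) / (Real.exp |δ| + 1) / |δ| := by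
      rw [div_div]
      have h3 := Real.add_one_le_exp |δ|
      have h4 := Real.exp_le_exp.2 hδ
      rw [div_le_div_iff₀ (by positivity) (by positivity)]
      calc 1 * ((Real.exp |δ| + 1) * |δ|) ≤ (Real.exp M + 1) * |δ| := by
            rw [one_mul]; exact mul_le_mul_of_nonneg_right (by linarith) h.le
        _ ≤ (Real.exp M + 1) * (Real.exp |δ| - 1) :=
            mul_le_mul_of_nonneg_left (by linarith) (by positivity)
        _ = _ := by ring
    have := weight_pos a |δ|
    exact mul_le_mul (by linarith) h2 (by positivity) (by positivity)

theorem le_q_one {a : ℝ} (ha : 0 < a) : 0.4 ≤ q a 1 := by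
  have he1 := Real.exp_one_gt_d9
  have he2 := Real.exp_one_lt_d9
  have hl := Real.log_two_gt_d9
  have hr : logSum 1 / (2 * Real.log 2) ≤ 2 := by
    rw [div_le_iff₀ (by linarith)]
    have h1 : Real.log (Real.exp 1 + 1) ≤ 2 * Real.log 2 := by
      rw [show 2 * Real.log 2 = Real.log (2 ^ 2) by rw [Real.log_pow]; norm_num]
      exact Real.log_le_log (by positivity) (by linarith)
    have h2 : Real.log (Real.exp (-1) + 1) ≤ Real.log 2 := by
      refine Real.log_le_log (by positivity) ?_
      have := Real.exp_le_one_iff.2 (show (-1 : ℝ) ≤ 0 by norm_num)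
      linarith
    rw [logSum]; linarith
  have hw := inv_le_weight ha hr
  rw [q_of_ne ha one_ne_zero, div_one]
  have h3 : 0.4 ≤ (Real.exp 1 - 1) / (Real.exp 1 + 1) := by
    rw [le_div_iff₀ (by positivity)]; linarith
  nlinarith

/-- A root d of q(d) = q(1)/2 satisfies d · q(1)/2 ≤ 2, and q(1) ≥ 0.4. -/
theorem qInv_le {a : ℝ} (ha : 0 < a) (ha1 : a ≤ 1) : qInv a (q a 1 / 2) ≤ 10 := by
  have h1 := le_q_one ha
  -- `invFunOn` is meaningful only if a root exists; [1, 10] contains one since q(10) ≤ 0.2 ≤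
  -- q(1)/2.
  have hex : ∃ d ∈ Set.Ici (0 : ℝ), q a d = q a 1 / 2 := by
    have hcont : ContinuousOn (q a) (Set.Icc 1 10) := by
      have hc : ContinuousOn (fun δ => 2 * weight a δ *
          ((Real.exp δ - 1) / (Real.exp δ + 1)) / δ) (Set.Icc 1 10) := by
        have hw : Continuous (weight a) :=
          (continuous_logSum.div_const _).rpow_const fun t =>
            Or.inl (by linarith [one_le_ratio t])
        have hE : Continuous fun δ : ℝ => (Real.exp δ - 1) / (Real.exp δ + 1) :=
          (Real.continuous_exp.sub continuous_const).div
            (Real.continuous_exp.add continuous_const) fun t => by positivity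
        exact ((continuous_const.mul hw).mul hE).continuousOn.div continuousOn_id
          fun t ht => by
            have := ht.1
            exact ne_of_gt (by linarith)
      exact hc.congr fun t ht => q_of_ne ha (by have := ht.1; linarith)
    have h10 := le_of_abs_le (abs_q_mul_le ha ha1 10)
    obtain ⟨d, hd, hd'⟩ := intermediate_value_Icc' (by norm_num) hcont
      (show q a 1 / 2 ∈ Set.Icc (q a 10) (q a 1) from ⟨by linarith, by linarith⟩)
    exact ⟨d, by have := hd.1; simp only [Set.mem_Ici]; linarith, hd'⟩
  have e : q a (qInv a (q a 1 / 2)) = q a 1 / 2 := Function.invFunOn_eq hex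
  have := le_of_abs_le (abs_q_mul_le ha ha1 (qInv a (q a 1 / 2)))
  rw [e] at this
  nlinarith

/-- `c₁` decreases in a and stays below its value at a = 0, about 0.264. This is the source of R ≥
22.75, hence of h ≤ 4/R ≤ 0.176. -/
theorem le_four_mul_c₁ {a : ℝ} (ha : 0 < a) (ha1 : a ≤ 1) :
    22.8 ≤ 4 * c₁ a ^ (-(4 / 3) : ℝ) := by
  have hl := Real.log_two_gt_d9
  have h0 : 0 < c₁ a := by
    rw [c₁]; exact div_pos (by linarith) (by linarith)
  have h1 : c₁ a ≤ 0.27 := by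
    rw [c₁, div_le_iff₀ (by linarith)]; linarith
  have h2 : (0.27 : ℝ) ^ (-(4 / 3) : ℝ) ≤ c₁ a ^ (-(4 / 3) : ℝ) :=
    Real.rpow_le_rpow_of_nonpos h0 h1 (by norm_num)
  have h3 : (5.7 : ℝ) ≤ (0.27 : ℝ) ^ (-(4 / 3) : ℝ) := by
    have e : ((0.27 : ℝ) ^ (-(4 / 3) : ℝ)) ^ 3 = ((0.27 : ℝ) ^ 4)⁻¹ := by
      rw [← Real.rpow_natCast, ← Real.rpow_mul (by norm_num), ← Real.rpow_natCast,
        ← Real.rpow_neg (by norm_num)]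
      norm_num
    refine le_of_pow_le_pow_left₀ (n := 3) (by norm_num) (by positivity) ?_
    rw [e]; norm_num
  linarith

theorem F_one_le {a : ℝ} (ha : 0 < a) (s : ℝ) : F a 1 ≤ F a s := by
  have e : logSum 0 = 2 * Real.log 2 := by
    simp only [logSum, neg_zero, Real.exp_zero]; norm_num; ring
  rw [F_eq, F_eq, sub_self, e]
  have := Real.log_pos one_lt_two
  exact mul_le_mul_of_nonneg_left
    (Real.rpow_le_rpow (by positivity) (two_log_two_le_logSum _) ha.le) (Ca_pos ha).le

theorem gradient_f {a : ℝ} (ha : 0 < a) (u : Plane) :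
    gradient (f a) u = (q a (u 0 * u 1 - 1) * (u 0 * u 1 - 1)) • !₂[u 1, u 0] := by
  refine HasGradientAt.gradient ?_
  rw [hasGradientAt_iff_hasFDerivAt]
  have hF : HasDerivAt (F a) (q a (u 0 * u 1 - 1) * (u 0 * u 1 - 1)) (u 0 * u 1) := by
    rw [← deriv_F_eq ha, add_sub_cancel]
    have := (hasDerivAt_F ha (u 0 * u 1 - 1)).differentiableAt
    rw [add_sub_cancel] at this
    exact this.hasDerivAt
  have hp : ∀ i : Fin 2, HasFDerivAt (fun v : Plane => v i)
      (EuclideanSpace.proj i : Plane →L[ℝ] ℝ) u := fun i =>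
    (EuclideanSpace.proj i : Plane →L[ℝ] ℝ).hasFDerivAt
  have := hF.comp_hasFDerivAt u ((hp 0).mul (hp 1))
  refine this.congr_fderiv ?_
  ext v
  simp [InnerProductSpace.toDual_apply_apply, PiLp.inner_apply, Fin.sum_univ_two]
  ring

end GoodRegularity

/-! ### The main theorem -/

theorem mainTheorem5 :
    ∃ c : ℝ, 0 < c ∧ ∀ a : ℝ, 0 < a → a ≤ 1 →
      ∃ B : Set GoodRegularity.Plane, volume B = 0 ∧
        ∀ u₀ : GoodRegularity.Plane, u₀ ∉ B →
          1 < u₀ 0 * u₀ 1 →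
          GoodRegularity.ApproxLE c u₀ (u₀ 0 * u₀ 1)
            (GoodRegularity.qInv a (GoodRegularity.q a 1 / 2)) →
          GoodRegularity.ApproxLE c u₀ (4 * GoodRegularity.c₁ a ^ (-(4 / 3) : ℝ))
            (GoodRegularity.sqNorm u₀) →
          ∀ K h : ℝ,
            2 / GoodRegularity.sqNorm u₀ <
              (2 / GoodRegularity.q a 1) / GoodRegularity.sqNorm u₀ +
                K / GoodRegularity.sqNorm u₀ ^ 2 →
            (2 / GoodRegularity.q a 1) / GoodRegularity.sqNorm u₀ +
                K / GoodRegularity.sqNorm u₀ ^ 2 ≤ h →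
            h ≤ 4 / GoodRegularity.sqNorm u₀ →
            ∃ uInf : GoodRegularity.Plane,
              Tendsto (GoodRegularity.gd a h u₀) atTop (𝓝 uInf) ∧
              IsMinOn (GoodRegularity.f a) Set.univ uInf ∧
              uInf 0 * uInf 1 = 1 := by
  -- As log R / R ≤ 1, c = 0.01 costs at most 0.01 in either hypothesis: R ≥ 22.8 − 0.01 and xy ≤ 10
  -- + 0.01.
  refine ⟨0.01, by norm_num, fun a ha ha1 => ⟨∅, measure_empty, ?_⟩⟩
  intro u₀ _ h1 hq hc K h hK hKh hh
  set R := GoodRegularity.sqNorm u₀ with hR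
  have hR2 : 2 ≤ R := by
    rw [hR, GoodRegularity.sqNorm]
    nlinarith [sq_nonneg (u₀ 0 - u₀ 1)]
  have hlog : Real.log R / R ≤ 1 := by
    rw [div_le_one (by linarith)]
    linarith [Real.log_le_sub_one_of_pos (show 0 < R by linarith)]
  have hR22 : 22.75 ≤ R := by
    have := GoodRegularity.le_four_mul_c₁ ha ha1
    rw [GoodRegularity.ApproxLE, ← hR] at hc
    norm_num at *
    linarith
  have hs : u₀ 0 * u₀ 1 ≤ 14 := by
    have := GoodRegularity.qInv_le ha ha1
    rw [GoodRegularity.ApproxLE, ← hR] at hq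
    norm_num at *
    linarith
  have hRpos : 0 < R := by linarith
  have hpos : 0 < h := (div_pos two_pos hRpos).trans (hK.trans_le hKh)
  obtain ⟨κ, hκ, hκq⟩ := GoodRegularity.exists_pos_le_q ha 13
  have hstep : ∀ k, GoodRegularity.gd a h u₀ (k + 1) = GoodRegularity.gd a h u₀ k -
      h • gradient (GoodRegularity.f a) (GoodRegularity.gd a h u₀ k) := fun k => rfl
  have T : GoodRegularity.Trajectory (fun k => GoodRegularity.gd a h u₀ k 0)
      (fun k => GoodRegularity.gd a h u₀ k 1) (GoodRegularity.q a) h κ :=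
    { h_pos := hpos
      h_le := hh.trans (by
        rw [div_le_iff₀ hRpos]
        norm_num at hR22 ⊢
        linarith)
      h_norm := by
        rw [le_div_iff₀ hRpos] at hh
        exact hh
      κ_pos := hκ
      Q_nonneg := GoodRegularity.q_nonneg ha
      Q_le_one := GoodRegularity.q_le_one ha ha1
      Q_mul_le := GoodRegularity.abs_q_mul_le ha ha1
      κ_le := hκq
      one_le := h1.le
      le_fourteen := hs
      X_succ := fun k => by
        rw [hstep, GoodRegularity.gradient_f ha]; simp
      Y_succ := fun k => by
        rw [hstep, GoodRegularity.gradient_f ha]; simp }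
  obtain ⟨x, y, hx, hy, hxy⟩ := T.exists_tendsto
  refine ⟨!₂[x, y], ?_, ?_, by simpa using hxy⟩
  · have hpi : Tendsto (fun k => (WithLp.ofLp (GoodRegularity.gd a h u₀ k) : Fin 2 → ℝ)) atTop
        (𝓝 ![x, y]) := by
      rw [tendsto_pi_nhds]
      intro i
      fin_cases i
      · exact hx
      · exact hy
    exact ((PiLp.continuous_toLp 2 _).tendsto _).comp hpi
  · intro v _
    change GoodRegularity.F a _ ≤ GoodRegularity.F a _
    simpa [hxy] using GoodRegularity.F_one_le ha (v 0 * v 1)
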